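/- An oriented graph $\overrightarrow{G}$ is a finite directed graph without loops and without opposite arcs; its underlying simple graph is denoted by $G$. Pushing a vertex $v$ means reversing all arcs incident with $v$. A pushable homomorphism from $\overrightarrow{G}$ to an oriented graph $\overrightarrow{H}$ is a map $\phi$ from $V(\overrightarrow{G})$ to $V(\overrightarrow{H})$ for which there is an oriented graph $\overrightarrow{G}'$, obtained from $\overrightarrow{G}$ by pushing some vertices, such that $\phi(u)\phi(v)$ is an arc of $\overrightarrow{H}$ for every arc $uv$ of $\overrightarrow{G}'$. The pushable chromatic number $\chi_p(\overrightarrow{G})$ is the minimum number of vertices of an oriented graph to which $\overrightarrow{G}$ admits a pushable homomorphism. For an undirected graph $G$, $\chi_p(G)$ is the maximum of $\chi_p(\overrightarrow{G})$ over all orientations $\overrightarrow{G}$ of $G$, and for a family $\mathcal{F}$ of finite graphs, $\chi_p(\mathcal{F})$ is the maximum of $\chi_p(G)$ over $G \in \mathcal{F}$. Let $\mathcal{G}_3$ be the family of all finite graphs with maximum degree $3$ and $\mathcal{G}^{\rm c}_3$ the family of all connected graphs in $\mathcal{G}_3$. The following hold. 1. $6 \leq \chi_p(\mathcal{G}^{\rm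 c}_3) \leq \chi_p(\mathcal{G}_3) \leq 7$, and the same inequalities hold if "maximum degree $3$" is replaced by "maximum degree at most $3$" in the definition of both families. 2. Every oriented graph whose underlying graph has maximum degree at most $3$ admits a pushable homomorphism to the Paley tournament $\overrightarrow{{\rm Pal}_7}$, the oriented graph with vertex set $\mathbb{Z}/7\mathbb{Z}$ in which $ij$ is an arc if and only if $j-i$ is a nonzero square. 3. The orientation of the complete bipartite graph $K_{3,3}$ with parts $\{a_0,a_1,a_2\}$ and $\{b_0,b_1,b_2\}$ whose arcs are $b_ia_i$ for all $i$ and $a_ib_j$ for all $i \neq j$ is a cubic oriented graph with pushable chromatic number $6$. -/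

import Mathlib

/-- An oriented graph on the vertex set `V`: a loopless directed graph without opposite arcs
(looplessness is the case `u = v` of `asymm`). -/
@[ext]
structure OrientedGraph (V : Type*) where
  /-- `Arc u v` says that `uv` is an arc. -/
  Arc : V → V → Prop
  asymm : ∀ u v, Arc u v → ¬ Arc v u

namespace OrientedGraph

/-- The underlying simple undirected graph. -/
def underlying {V : Type*} (D : OrientedGraph V) : SimpleGraph V where
  Adj u v := D.Arc u v ∨ D.Arc v u
  symm := ⟨fun _ _ h => Or.symm h⟩
  loopless := ⟨fun v h => h.elim (fun h' => D.asymm v v h' h') (fun h' => D.asymm v v h' h')⟩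

/-- Pushing the vertex `x`: all arcs incident with `x` are reversed, the others are kept. -/
def push {V : Type*} (D : OrientedGraph V) (x : V) : OrientedGraph V where
  Arc u v := ((u = x ∨ v = x) ∧ D.Arc v u) ∨ (¬ (u = x ∨ v = x) ∧ D.Arc u v)
  asymm u v := by
    have h1 := D.asymm u v
    have h2 := D.asymm v u
    tauto

/-- `D'` is obtained from `D` by pushing some vertices (one after the other). -/
def PushRelated {V : Type*} (D D' : OrientedGraph V) : Prop :=
  Relation.ReflTransGen (fun D₁ D₂ : OrientedGraph V => ∃ x, D₂ = D₁.push x) D D'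

/-- `φ` is a homomorphism of oriented graphs. -/
def IsHom {V W : Type*} (D : OrientedGraph V) (H : OrientedGraph W) (φ : V → W) : Prop :=
  ∀ u v, D.Arc u v → H.Arc (φ u) (φ v)

/-- `φ` is a pushable homomorphism: a homomorphism to `H` of some oriented graph in the push
class of `D`. -/
def IsPushHom {V W : Type*} (D : OrientedGraph V) (H : OrientedGraph W) (φ : V → W) : Prop :=
  ∃ D' : OrientedGraph V, D.PushRelated D' ∧ D'.IsHom H φ

/-- There is a pushable homomorphism from `D` to `H`. -/
def PushMapsTo {V W : Type*} (D : OrientedGraph V) (H : OrientedGraph W) : Prop :=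
  ∃ φ : V → W, D.IsPushHom H φ

/-- The pushable chromatic number of an oriented graph: the minimum order of an oriented graph
to which it admits a pushable homomorphism (`⊤` if there is no finite one, which cannot happen
for finite `V`). -/
noncomputable def pushChromatic {V : Type*} (D : OrientedGraph V) : ℕ∞ :=
  ⨅ n ∈ {n : ℕ | ∃ H : OrientedGraph (Fin n), D.PushMapsTo H}, (n : ℕ∞)

/-- The Paley tournament on seven vertices: `ij` is an arc iff `j - i` is a nonzero square. -/
def pal7 : OrientedGraph (ZMod 7) where
  Arc i j := j - i ≠ 0 ∧ IsSquare (j - i)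
  asymm := by decide

/-- The orientation of the complete bipartite graph `K₃,₃` with parts `{a₀, a₁, a₂}` (`Sum.inl`)
and `{b₀, b₁, b₂}` (`Sum.inr`) whose arcs are `bᵢaᵢ` for all `i` and `aᵢbⱼ` for all `i ≠ j`. -/
def orientedK33 : OrientedGraph (Fin 3 ⊕ Fin 3) where
  Arc u v := (∃ i j, i ≠ j ∧ u = Sum.inl i ∧ v = Sum.inr j) ∨
    (∃ i, u = Sum.inr i ∧ v = Sum.inl i)
  asymm := by
    rintro u v (⟨i, j, hij, rfl, rfl⟩ | ⟨i, rfl, rfl⟩) <;> simp [eq_comm] at * <;> assumption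

end OrientedGraph

/-- The pushable chromatic number of an undirected graph: the maximum of the pushable chromatic
numbers of its orientations. -/
noncomputable def SimpleGraph.pushChromatic {V : Type*} (G : SimpleGraph V) : ℕ∞ :=
  ⨆ D ∈ {D : OrientedGraph V | D.underlying = G}, D.pushChromatic

/-- The maximum degree of a finite graph. -/
noncomputable def SimpleGraph.maxDeg {V : Type*} [Fintype V] (G : SimpleGraph V) : ℕ :=
  open Classical in G.maxDegree

/-- A family of finite graphs, the graphs being taken, up to isomorphism, on the vertex sets
`{0, …, n - 1}`. -/
abbrev GraphFamily : Type := Set (Σ n : ℕ, SimpleGraph (Fin n))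

namespace GraphFamily

/-- The pushable chromatic number of a family: the maximum over its members (`⊤` if they are
unbounded). -/
noncomputable def pushChromatic (F : GraphFamily) : ℕ∞ :=
  ⨆ G ∈ F, G.2.pushChromatic

/-- The finite graphs with maximum degree `Δ`. -/
def maxDegEq (Δ : ℕ) : GraphFamily := {G | G.2.maxDeg = Δ}

/-- The connected finite graphs with maximum degree `Δ`. -/
def connMaxDegEq (Δ : ℕ) : GraphFamily := {G | G.2.Connected ∧ G.2.maxDeg = Δ}

/-- The finite graphs with maximum degree at most `Δ`. -/
def maxDegLE (Δ : ℕ) : GraphFamily := {G | G.2.maxDeg ≤ Δ}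

/-- The connected finite graphs with maximum degree at most `Δ`. -/
def connMaxDegLE (Δ : ℕ) : GraphFamily := {G | G.2.Connected ∧ G.2.maxDeg ≤ Δ}

end GraphFamily

/-! ### Closed walks in the antitwinned Paley tournament -/

namespace OrientedGraph

/-! Upper bound. Adding an antitwin to every vertex of the Paley tournament gives a Cayley digraph
on `ZMod 14` with connection set `conn`, and an ordinary homomorphism to it yields a pushable
homomorphism to `pal7`. Since `conn` is stable under `x ↦ 7 - x`, giving each edge the gain 0 or 7
according to its direction turns the problem into colouring a gain graph (`EdgeOK`).

Such colourings are built by strong induction on the vertex set. A vertex with at most one remaining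
neighbour is removed and coloured last. Otherwise there is a chordless cycle; its complement is
coloured first. By the degree bound each cycle vertex has at most one neighbour off the cycle, so
its colour may be any element of a translate of `conn`. Completing the cycle then means finding a
closed walk in `conn` with prescribed translations of its differences (`exists_closed_walk`). Such a
walk always exists, by a finite computation: the pairs of sets reachable from 8 and from 2 never
leave the up-closure of a short list (`reachPairs`), and each listed pair lets one of the two walks
return to its start.

Lower bound. In `orientedK33`, any two nonadjacent vertices lie on a 4-cycle where exactly one of
the two paths joining them is directed. Pushing preserves this, so no two vertices can be
identified. -/

/-- Bit mask of the connection set of the Cayley digraph below. -/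
def connMask : ℕ := 8508

/-- The connection set of the Cayley digraph on `ZMod 14` that is obtained from the Paley tournament
by adding an antitwin to every vertex: `k` stands for the vertex `k mod 7`, pushed iff `k` is odd. -/
def conn : Finset (ZMod 14) := {2, 3, 4, 5, 8, 13}

/-- The elements `e` of the connection set such that `e - d + g` is in it, too, as a bit mask. -/
def rowMask (g d : ℕ) : ℕ := connMask &&& ((connMask * 16385) >>> ((g + 14 - d) % 14))

/-- The union of `rowMask g d` over the elements `d` of the set with bit mask `S`. -/
def stepMask (g S : ℕ) : ℕ :=
  [2, 3, 4, 5, 8, 13].foldr (fun d T => bif S.testBit d then rowMask g d ||| T else T) 0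

/-- Pairs of subsets of the connection set: a family that is closed, up to inclusion, under every
`stepMask`, and whose members contain `8` in the first or `2` in the second set. -/
def reachPairs : List (ℕ × ℕ) :=
  [(40, 44), (8228, 292), (296, 40), (8456, 8200), (272, 272), (20, 8204), (20, 8228), (8228, 20),
    (260, 8484), (20, 20), (40, 292), (292, 292), (8200, 8204), (8228, 8228), (8240, 8228)]

/-- A pair of sets contains one of the listed pairs. -/
def IsRich (S T : ℕ) : Bool := reachPairs.any fun m => (m.1 &&& S).beq m.1 && (m.2 &&& T).beq m.2

theorem rich_step : ∀ m ∈ reachPairs, ∀ g < 14, IsRich (stepMask g m.1) (stepMask g m.2) := by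
  decide +kernel

/-- Base of the invariant: up to a multiplier `t`, three steps with arbitrary gains lead into the
listed family. The masks 256 and 4 are the singletons of 8 and 2; the multipliers 1, 9, 11 permute
`conn`. -/
theorem rich_start : ∀ a < 14, ∀ b < 14, ∀ c < 14, ∃ t ∈ [1, 9, 11],
    IsRich (stepMask (t * c % 14) (stepMask (t * b % 14) (stepMask (t * a % 14) 256)))
      (stepMask (t * c % 14) (stepMask (t * b % 14) (stepMask (t * a % 14) 4))) := by
  decide +kernel

/-- The factor 16385 is `2 ^ 14 + 1`: it writes two copies of the mask side by side, so that the
right shift acts as a cyclic rotation on the low 14 bits. -/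
theorem rowMask_spec : ∀ g < 14, ∀ d ∈ [2, 3, 4, 5, 8, 13], ∀ e < 14, (rowMask g d).testBit e →
    (e : ZMod 14) ∈ conn ∧ (e : ZMod 14) - (d : ℕ) + (g : ℕ) ∈ conn := by
  decide +kernel

theorem lt_of_testBit_rowMask {g d e : ℕ} (h : (rowMask g d).testBit e) : e < 14 := by
  by_contra! he
  have h1 : connMask.testBit e = true := by
    rw [rowMask, Nat.testBit_land] at h
    simp_all
  rw [Nat.testBit_lt_two_pow] at h1
  · simp at h1
  · exact lt_of_lt_of_le (by decide : connMask < 2 ^ 14) (Nat.pow_le_pow_right (by norm_num) he)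

theorem exists_of_testBit_stepMask {g S e : ℕ} (hg : g < 14) (h : (stepMask g S).testBit e) :
    ∃ d, S.testBit d ∧ (e : ZMod 14) ∈ conn ∧ (e : ZMod 14) - (d : ℕ) + (g : ℕ) ∈ conn := by
  suffices H : ∀ l : List ℕ, (∀ d ∈ l, d ∈ [2, 3, 4, 5, 8, 13]) →
      (l.foldr (fun d T => bif S.testBit d then rowMask g d ||| T else T) 0).testBit e →
      ∃ d, S.testBit d ∧ (e : ZMod 14) ∈ conn ∧ (e : ZMod 14) - (d : ℕ) + (g : ℕ) ∈ conn from
    H _ (fun _ h => h) h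
  intro l
  induction l with
  | nil => simp
  | cons d l ih =>
    intro hl he
    rw [List.foldr_cons] at he
    cases hS : S.testBit d with
    | false =>
      rw [hS, cond_false] at he
      exact ih (fun x hx => hl x (List.mem_cons_of_mem _ hx)) he
    | true =>
      rw [hS, cond_true, Nat.testBit_lor, Bool.or_eq_true] at he
      rcases he with he | he
      · exact ⟨d, hS, rowMask_spec g hg d (hl d List.mem_cons_self) e (lt_of_testBit_rowMask he) he⟩
      · exact ih (fun x hx => hl x (List.mem_cons_of_mem _ hx)) he

/-- `e` is the end of a walk with `n` steps that starts at `a`, has its other vertices in the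
connection set, and has its `i`-th difference in the connection set after translation by `g i`. -/
def Reach (g : ℕ → ZMod 14) (a : ZMod 14) : ℕ → ZMod 14 → Prop
  | 0, e => e = a
  | n + 1, e => e ∈ conn ∧ ∃ d, Reach g a n d ∧ e - d + g n ∈ conn

theorem Reach.exists_walk {g : ℕ → ZMod 14} {a : ZMod 14} (ha : a ∈ conn) {n : ℕ} {e : ZMod 14}
    (h : Reach g a n e) : ∃ d : ℕ → ZMod 14, d 0 = a ∧ d n = e ∧ (∀ i, d i ∈ conn) ∧
      ∀ i < n, d (i + 1) - d i + g i ∈ conn := by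
  induction n generalizing e with
  | zero => exact ⟨fun _ => a, rfl, h.symm, fun _ => ha, by simp⟩
  | succ n ih =>
    obtain ⟨he, x, hx, hxe⟩ := h
    obtain ⟨d, h0, hn, hd, hs⟩ := ih hx
    refine ⟨fun i => if i ≤ n then d i else e, by simpa, by simp, fun i => ?_, fun i hi => ?_⟩
    · dsimp only
      split_ifs
      exacts [hd i, he]
    · rcases Nat.lt_succ_iff_lt_or_eq.mp hi with hi | rfl
      · simpa [hi.le, Nat.succ_le_of_lt hi] using hs i hi
      · simpa [hn] using hxe

/-- All members of the set with bit mask `S` are reached in `n` steps. -/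
def Covers (g : ℕ → ZMod 14) (a : ZMod 14) (n S : ℕ) : Prop :=
  ∀ e : ℕ, S.testBit e → Reach g a n e

theorem Covers.step {g : ℕ → ZMod 14} {a : ZMod 14} {n S : ℕ} (h : Covers g a n S) :
    Covers g a (n + 1) (stepMask (g n).val S) := by
  intro e he
  obtain ⟨d, hd, h1, h2⟩ := exists_of_testBit_stepMask (ZMod.val_lt (g n)) he
  rw [ZMod.natCast_zmod_val] at h2
  exact ⟨h1, d, h d hd, h2⟩

/-- `Covers` bounds the reachable set only from below, so after each step the masks may shrink to a
listed pair. Monotonicity of `stepMask` is thus never needed. -/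
theorem Covers.of_land {g : ℕ → ZMod 14} {a : ZMod 14} {n S m : ℕ} (h : Covers g a n S)
    (hm : (m &&& S).beq m) : Covers g a n m := by
  intro e he
  rw [← Nat.eq_of_beq_eq_true hm, Nat.testBit_land, Bool.and_eq_true] at he
  exact h e he.2

theorem exists_covers_of_isRich {g : ℕ → ZMod 14} {n S T : ℕ} (h : IsRich S T)
    (hS : Covers g 8 n S) (hT : Covers g 2 n T) :
    ∃ m ∈ reachPairs, Covers g 8 n m.1 ∧ Covers g 2 n m.2 := by
  obtain ⟨m, hm, h⟩ := List.any_eq_true.mp h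
  rw [Bool.and_eq_true] at h
  exact ⟨m, hm, hS.of_land h.1, hT.of_land h.2⟩

theorem exists_closed_walk_of_isRich {g : ℕ → ZMod 14}
    (h : IsRich (stepMask (g 2).val (stepMask (g 1).val (stepMask (g 0).val 256)))
      (stepMask (g 2).val (stepMask (g 1).val (stepMask (g 0).val 4)))) {n : ℕ} (hn : 3 ≤ n) :
    ∃ d : ℕ → ZMod 14, d n = d 0 ∧ (∀ i, d i ∈ conn) ∧ ∀ i < n, d (i + 1) - d i + g i ∈ conn := by
  have H : ∃ m ∈ reachPairs, Covers g 8 n m.1 ∧ Covers g 2 n m.2 := by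
    induction n, hn using Nat.le_induction with
    | base =>
      have single : ∀ a : ℕ, Covers g a 0 (2 ^ a) := by
        intro a e he
        rw [Nat.testBit_two_pow, decide_eq_true_eq] at he
        exact congrArg _ he.symm
      exact exists_covers_of_isRich h (single 8).step.step.step (single 2).step.step.step
    | succ n hn ih =>
      obtain ⟨m, hm, h1, h2⟩ := ih
      exact exists_covers_of_isRich (rich_step m hm _ (ZMod.val_lt (g n))) h1.step h2.step
  obtain ⟨m, hm, h1, h2⟩ := H
  -- The walk from 8 can end at 8, or the walk from 2 can end at 2.
  have hclose : ∀ m ∈ reachPairs, m.1.testBit 8 ∨ m.2.testBit 2 := by decide +kernel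
  rcases hclose m hm with hm | hm
  · obtain ⟨d, h0, hn, h⟩ := (h1 8 hm).exists_walk (by decide)
    exact ⟨d, hn.trans h0.symm, h⟩
  · obtain ⟨d, h0, hn, h⟩ := (h2 2 hm).exists_walk (by decide)
    exact ⟨d, hn.trans h0.symm, h⟩

/-- Every cyclic sequence of at least three translations admits a closed walk in the connection
set. -/
theorem exists_closed_walk (g : ℕ → ZMod 14) {n : ℕ} (hn : 3 ≤ n) :
    ∃ d : ℕ → ZMod 14, d n = d 0 ∧ (∀ i, d i ∈ conn) ∧ ∀ i < n, d (i + 1) - d i + g i ∈ conn := by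
  obtain ⟨t, ht, h⟩ := rich_start _ (ZMod.val_lt (g 0)) _ (ZMod.val_lt (g 1)) _ (ZMod.val_lt (g 2))
  have hval : ∀ x : ZMod 14, ((t : ZMod 14) * x).val = t * x.val % 14 := by
    intro x
    rw [ZMod.val_mul, ZMod.val_natCast, Nat.mod_mul_mod]
  simp only [← hval] at h
  obtain ⟨d, h0, hd, hs⟩ := exists_closed_walk_of_isRich (g := fun i => t * g i) h hn
  -- Here `s` is the inverse of `t`; it maps a walk for the gains `t * g i` back to one for `g i`.
  have hmul : ∀ t ∈ [1, 9, 11], ∃ s : ZMod 14, s * (t : ℕ) = 1 ∧ ∀ x ∈ conn, s * x ∈ conn := by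
    decide
  obtain ⟨s, hst, hsc⟩ := hmul t ht
  refine ⟨fun i => s * d i, congrArg _ h0, fun i => hsc _ (hd i), fun i hi => ?_⟩
  have := hsc _ (hs i hi)
  rwa [mul_add, mul_sub, ← mul_assoc, hst, one_mul] at this

end OrientedGraph

/-! ### Chordless cycles in finite graphs of minimum degree two -/

namespace SimpleGraph

variable {V : Type*} {G : SimpleGraph V}

/-- `w` is a walk `w 0, …, w n` in `S` without immediate returns. -/
structure IsNonbacktracking (G : SimpleGraph V) (S : Finset V) (n : ℕ) (w : ℕ → V) : Prop where
  mem : ∀ i ≤ n, w i ∈ S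
  adj : ∀ i < n, G.Adj (w i) (w (i + 1))
  ne : ∀ i, i + 2 ≤ n → w (i + 2) ≠ w i

/-- `w 0, …, w n` are the vertices of a chordless cycle in `S`, in cyclic order. -/
structure IsChordlessCycle (G : SimpleGraph V) (S : Finset V) (n : ℕ) (w : ℕ → V) : Prop where
  two_le : 2 ≤ n
  mem : ∀ i ≤ n, w i ∈ S
  adj : ∀ i < n, G.Adj (w i) (w (i + 1))
  adj_last : G.Adj (w n) (w 0)
  inj : ∀ i j, i < j → j ≤ n → w i ≠ w j
  chordless : ∀ i j, i < j → j ≤ n → G.Adj (w i) (w j) → j = i + 1 ∨ i = 0 ∧ j = n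

theorem exists_isNonbacktracking {S : Finset V} (hne : S.Nonempty)
    (h : ∀ v ∈ S, ∀ o, ∃ y ∈ S, G.Adj v y ∧ y ≠ o) :
    ∃ w : ℕ → V, ∀ n, G.IsNonbacktracking S n w := by
  obtain ⟨v, hv⟩ := hne
  choose next hmem hadj hne using h
  let q : ℕ → S × S := fun n => n.rec (⟨v, hv⟩, ⟨v, hv⟩)
    (fun _ p => (p.2, ⟨next p.2 p.2.2 p.1, hmem p.2 p.2.2 p.1⟩))
  exact ⟨fun i => (q i).2, fun n => ⟨fun i _ => (q i).2.2, fun i _ => hadj _ (q i).2.2 _,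
    fun i _ => hne _ (q (i + 1)).2.2 _⟩⟩

theorem IsNonbacktracking.shift {S : Finset V} {n : ℕ} {w : ℕ → V} (h : G.IsNonbacktracking S n w)
    {i j : ℕ} (hij : i ≤ j) (hj : j ≤ n) :
    G.IsNonbacktracking S (j - i) (fun k => w (i + k)) where
  mem k hk := h.mem _ (by omega)
  adj k hk := h.adj _ (by omega)
  ne k hk := h.ne (i + k) (by omega)

/-- An endless nonbacktracking walk in a finite set repeats a vertex, which gives a segment of
length at least 2 with adjacent ends. In a shortest such segment, a repetition or a chord would
produce a shorter one. -/
theorem exists_isChordlessCycle {S : Finset V} (hne : S.Nonempty)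
    (h : ∀ v ∈ S, ∀ o, ∃ y ∈ S, G.Adj v y ∧ y ≠ o) : ∃ n w, G.IsChordlessCycle S n w := by
  classical
  let P : ℕ → Prop := fun n => 2 ≤ n ∧ ∃ w, G.IsNonbacktracking S n w ∧ G.Adj (w 0) (w n)
  have hP : ∀ {n w i j}, G.IsNonbacktracking S n w → i + 2 ≤ j → j ≤ n → G.Adj (w i) (w j) →
      P (j - i) := by
    intro n w i j hw hij hj hadj
    refine ⟨by omega, _, hw.shift (by omega) hj, ?_⟩
    simpa [show i + (j - i) = j by omega] using hadj
  have hrep : ∀ {n w i j}, G.IsNonbacktracking S n w → i < j → j ≤ n → w i = w j →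
      i + 2 ≤ j - 1 ∧ G.Adj (w i) (w (j - 1)) := by
    intro n w i j hw hij hj heq
    have hadj := hw.adj (j - 1) (by omega)
    rw [show j - 1 + 1 = j by omega, ← heq] at hadj
    refine ⟨?_, hadj.symm⟩
    by_contra! hlt
    rcases (by omega : j - 1 = i ∨ j = i + 2) with h1 | rfl
    · rw [h1] at hadj
      exact hadj.ne rfl
    · exact hw.ne i hj heq.symm
  have hex : ∃ n, P n := by
    obtain ⟨w, hw⟩ := exists_isNonbacktracking hne h
    obtain ⟨i, j, hij, heq⟩ := Finite.exists_ne_map_eq_of_infinite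
      (fun k : ℕ => (⟨w k, (hw k).mem k le_rfl⟩ : S))
    replace heq : w i = w j := congrArg Subtype.val heq
    wlog hlt : i < j generalizing i j
    · exact this j i hij.symm heq.symm (by omega)
    obtain ⟨h1, h2⟩ := hrep (hw j) hlt le_rfl heq
    exact ⟨_, hP (hw j) h1 (by omega) h2⟩
  obtain ⟨h2, w, hw, hadj⟩ := Nat.find_spec hex
  have hmin : ∀ m, P m → Nat.find hex ≤ m := fun m hm => Nat.find_min' hex hm
  generalize Nat.find hex = n at h2 hw hadj hmin
  refine ⟨n, w, h2, hw.mem, hw.adj, hadj.symm, fun i j hij hj heq => ?_, fun i j hij hj ha => ?_⟩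
  · obtain ⟨h1, h2⟩ := hrep hw hij hj heq
    have := hmin _ (hP hw h1 (by omega) h2)
    omega
  · by_contra! hne
    have := hmin _ (hP hw (by omega) hj ha)
    omega

/-- A vertex of a chordless cycle in a subcubic graph has at most one neighbour outside. -/
theorem IsChordlessCycle.exists_forall_adj {S : Finset V} {n : ℕ} {w : ℕ → V}
    (hw : G.IsChordlessCycle S n w)
    (hdeg : ∀ v a b c d, G.Adj v a → G.Adj v b → G.Adj v c → G.Adj v d → a ≠ b → c ≠ a → c ≠ b →
      d ≠ a → d ≠ b → c = d) {i : ℕ} (hi : i ≤ n) :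
    ∃ o, ∀ y, G.Adj (w i) y → (∀ j ≤ n, w j ≠ y) → y = o := by
  have h2 := hw.two_le
  obtain ⟨j, k, hj, hk, hjk, haj, hak⟩ :
      ∃ j k, j ≤ n ∧ k ≤ n ∧ j < k ∧ G.Adj (w i) (w j) ∧ G.Adj (w i) (w k) := by
    rcases Nat.eq_zero_or_pos i with rfl | h0
    · exact ⟨1, n, by omega, le_rfl, by omega, hw.adj 0 (by omega), hw.adj_last.symm⟩
    have hpred := (hw.adj (i - 1) (by omega)).symm
    rw [show i - 1 + 1 = i by omega] at hpred
    rcases hi.lt_or_eq with hlt | rfl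
    · exact ⟨i - 1, i + 1, by omega, hlt, by omega, hpred, hw.adj i hlt⟩
    · exact ⟨0, i - 1, by omega, by omega, by omega, hw.adj_last, hpred⟩
  by_cases hex : ∃ o, G.Adj (w i) o ∧ ∀ j ≤ n, w j ≠ o
  · obtain ⟨o, ho, hout⟩ := hex
    exact ⟨o, fun y hy hyout => hdeg _ _ _ _ _ haj hak hy ho (hw.inj j k hjk hk)
      (hyout j hj).symm (hyout k hk).symm (hout j hj).symm (hout k hk).symm⟩
  -- Without an outside neighbour the condition is vacuous and any `o` serves.
  · exact ⟨w 0, fun y hy hyout => (hex ⟨y, hy, hyout⟩).elim⟩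

end SimpleGraph

/-! ### Colouring subcubic gain graphs -/

namespace OrientedGraph

variable {V : Type*} {G : SimpleGraph V}

/-- The edge `uv`, with gain `s u v`, is properly coloured by `κ`. -/
def EdgeOK (s : V → V → ZMod 14) (κ : V → ZMod 14) (u v : V) : Prop := κ v - κ u + s u v ∈ conn

/-- Since `conn` is stable under `x ↦ 7 - x`, it does not matter in which direction an edge is read.
-/
theorem EdgeOK.symm {s : V → V → ZMod 14} {κ : V → ZMod 14} {u v : V} (hs : s v u = 7 - s u v)
    (h : EdgeOK s κ u v) : EdgeOK s κ v u := by
  have hneg : ∀ x ∈ conn, 7 - x ∈ conn := by decide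
  have := hneg _ h
  rw [EdgeOK, hs]
  convert this using 1
  ring

/-- A colouring of the complement of a chordless cycle extends to the cycle. -/
theorem exists_extend_cycle {s : V → V → ZMod 14}
    (hs : ∀ u v, G.Adj u v → s v u = 7 - s u v)
    (hdeg : ∀ v a b c d, G.Adj v a → G.Adj v b → G.Adj v c → G.Adj v d → a ≠ b → c ≠ a → c ≠ b →
      d ≠ a → d ≠ b → c = d) {S : Finset V} {n : ℕ} {w : ℕ → V} (hw : G.IsChordlessCycle S n w)
    {κ : V → ZMod 14}
    (hκ : ∀ u ∈ S, ∀ v ∈ S, (∀ i ≤ n, w i ≠ u) → (∀ i ≤ n, w i ≠ v) → G.Adj u v → EdgeOK s κ u v) :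
    ∃ κ' : V → ZMod 14, ∀ u ∈ S, ∀ v ∈ S, G.Adj u v → EdgeOK s κ' u v := by
  classical
  have hout : ∀ i, ∃ o, i ≤ n → ∀ y, G.Adj (w i) y → (∀ j ≤ n, w j ≠ y) → y = o := fun i => by
    by_cases hi : i ≤ n
    · exact (hw.exists_forall_adj hdeg hi).imp fun _ h _ => h
    · exact ⟨w 0, fun h => absurd h hi⟩
  choose o ho using hout
  -- With the colour of `w i` written as `p i + d i`, the edge from `o i` to `w i` is proper exactly
  -- when `d i ∈ conn`.
  let p : ℕ → ZMod 14 := fun i => κ (o i) - s (o i) (w i)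
  -- The cycle has `n + 1` edges; step `n` is the closing edge from `w n` to `w 0`, with `d (n + 1)
  -- = d 0`.
  obtain ⟨d, hclose, hd, hstep⟩ := exists_closed_walk
    (fun i => if i < n then p (i + 1) - p i + s (w i) (w (i + 1)) else p 0 - p n + s (w n) (w 0))
    (show 3 ≤ n + 1 by have := hw.two_le; omega)
  let κ' : V → ZMod 14 := fun v =>
    if h : ∃ i ≤ n, w i = v then p (Nat.find h) + d (Nat.find h) else κ v
  have hin : ∀ i ≤ n, κ' (w i) = p i + d i := by
    intro i hi
    have h : ∃ j ≤ n, w j = w i := ⟨i, hi, rfl⟩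
    have heq : Nat.find h = i := by
      obtain ⟨h1, h2⟩ := Nat.find_spec h
      by_contra hne
      rcases lt_or_gt_of_ne hne with hlt | hlt
      · exact hw.inj _ _ hlt hi h2
      · exact hw.inj _ _ hlt h1 h2.symm
    simp only [κ', dif_pos h, heq]
  have hnotin : ∀ v, (∀ i ≤ n, w i ≠ v) → κ' v = κ v := by
    intro v hv
    have h : ¬ ∃ i ≤ n, w i = v := by push Not; exact hv
    simp only [κ', dif_neg h]
  have hmixed : ∀ u, (∀ i ≤ n, w i ≠ u) → ∀ i ≤ n, G.Adj u (w i) → EdgeOK s κ' u (w i) := by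
    intro u hu i hi hadj
    have huo : u = o i := ho i hi u hadj.symm hu
    rw [EdgeOK, hin i hi, hnotin u hu, huo]
    convert hd i using 1
    simp only [p]
    ring
  have hcyc : ∀ i j, i < j → j ≤ n → G.Adj (w i) (w j) → EdgeOK s κ' (w i) (w j) := by
    intro i j hij hj hadj
    rcases hw.chordless i j hij hj hadj with rfl | ⟨rfl, rfl⟩
    · have := hstep i (by omega)
      rw [if_pos (by omega : i < n)] at this
      rw [EdgeOK, hin _ hj, hin _ (by omega)]
      convert this using 1
      ring
    · have := hstep j (by omega)
      rw [if_neg (lt_irrefl j), hclose] at this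
      refine EdgeOK.symm (hs _ _ hadj.symm) ?_
      rw [EdgeOK, hin _ hj, hin _ (by omega)]
      convert this using 1
      ring
  refine ⟨κ', fun u huS v hvS hadj => ?_⟩
  by_cases hu : ∃ i ≤ n, w i = u
  · obtain ⟨i, hi, rfl⟩ := hu
    by_cases hv : ∃ j ≤ n, w j = v
    · obtain ⟨j, hj, rfl⟩ := hv
      rcases lt_trichotomy i j with h | rfl | h
      · exact hcyc i j h hj hadj
      · exact (hadj.ne rfl).elim
      · exact (hcyc j i h hi hadj.symm).symm (hs _ _ hadj.symm)
    · push Not at hv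
      exact (hmixed v hv i hi hadj.symm).symm (hs _ _ hadj.symm)
  · push Not at hu
    by_cases hv : ∃ j ≤ n, w j = v
    · obtain ⟨j, hj, rfl⟩ := hv
      exact hmixed u hu j hj hadj
    · push Not at hv
      have := hκ u huS v hvS hu hv hadj
      rwa [EdgeOK, hnotin u hu, hnotin v hv]

/-- Subcubic gain graphs with gains `0` and `7` are colourable, on every finite set of vertices. -/
theorem exists_coloring {s : V → V → ZMod 14}
    (hs : ∀ u v, G.Adj u v → s v u = 7 - s u v)
    (hdeg : ∀ v a b c d, G.Adj v a → G.Adj v b → G.Adj v c → G.Adj v d → a ≠ b → c ≠ a → c ≠ b →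
      d ≠ a → d ≠ b → c = d) (S : Finset V) :
    ∃ κ : V → ZMod 14, ∀ u ∈ S, ∀ v ∈ S, G.Adj u v → EdgeOK s κ u v := by
  classical
  induction S using Finset.strongInduction with
  | H S ih =>
  rcases S.eq_empty_or_nonempty with rfl | hne
  · exact ⟨fun _ => 0, by simp⟩
  by_cases hdeg1 : ∃ v ∈ S, ∃ o, ∀ y ∈ S, G.Adj v y → y = o
  · obtain ⟨v, hv, o, ho⟩ := hdeg1
    obtain ⟨κ, hκ⟩ := ih _ (Finset.erase_ssubset hv)
    -- Only the neighbour `o` can constrain `v`; 2 is an arbitrary choice from `conn`.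
    have hnew : ∀ u ∈ S, G.Adj u v →
        EdgeOK s (Function.update κ v (κ o - s o v + 2)) u v := by
      intro u hu hadj
      have huo := ho u hu hadj.symm
      rw [EdgeOK, Function.update_self, Function.update_of_ne hadj.ne, huo]
      convert (by decide : (2 : ZMod 14) ∈ conn) using 1
      ring
    refine ⟨Function.update κ v (κ o - s o v + 2), fun x hx y hy hadj => ?_⟩
    by_cases hyv : y = v
    · subst hyv
      exact hnew x hx hadj
    by_cases hxv : x = v
    · subst hxv
      exact (hnew y hy hadj.symm).symm (hs _ _ hadj.symm)
    rw [EdgeOK, Function.update_of_ne hxv, Function.update_of_ne hyv]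
    exact hκ x (Finset.mem_erase.mpr ⟨hxv, hx⟩) y (Finset.mem_erase.mpr ⟨hyv, hy⟩) hadj
  · push Not at hdeg1
    obtain ⟨n, w, hw⟩ := SimpleGraph.exists_isChordlessCycle hne hdeg1
    obtain ⟨κ, hκ⟩ := ih (S.filter fun v => ∀ i ≤ n, w i ≠ v)
      (Finset.filter_ssubset.mpr ⟨w 0, hw.mem 0 (by omega), fun h => h 0 (by omega) rfl⟩)
    refine exists_extend_cycle hs hdeg hw (κ := κ) fun u hu v hv hu' hv' hadj => ?_
    exact hκ u (Finset.mem_filter.mpr ⟨hu, hu'⟩) v (Finset.mem_filter.mpr ⟨hv, hv'⟩) hadj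

end OrientedGraph

/-! ### Push classes and homomorphisms to the Paley tournament -/

namespace OrientedGraph

variable {V W : Type*}

/-- The oriented graph obtained by pushing all vertices `v` with `σ v = true`. -/
def twist (D : OrientedGraph V) (σ : V → Bool) : OrientedGraph V where
  Arc u v := (σ u = σ v ∧ D.Arc u v) ∨ (σ u ≠ σ v ∧ D.Arc v u)
  asymm u v := by
    have h1 := D.asymm u v
    have h2 := D.asymm v u
    have h3 : σ v = σ u ↔ σ u = σ v := eq_comm
    tauto

theorem arc_irrefl (D : OrientedGraph V) (v : V) : ¬ D.Arc v v := fun h => D.asymm v v h h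

/-- Pushing twice at a vertex cancels, so only the set of vertices pushed an odd number of times
matters. A push class is thereby parametrized by Boolean functions. -/
theorem push_twist [DecidableEq V] (D : OrientedGraph V) (σ : V → Bool) (x : V) :
    (D.twist σ).push x = D.twist (Function.update σ x (!σ x)) := by
  ext u v
  have hx := D.arc_irrefl x
  by_cases hu : u = x <;> by_cases hv : v = x
  · subst hu hv
    simp [push, twist, hx]
  · subst hu
    cases h1 : σ u <;> cases h2 : σ v <;> simp [push, twist, hv, h1, h2]
  · subst hv
    cases h1 : σ u <;> cases h2 : σ v <;> simp [push, twist, hu, h1, h2]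
  · simp [push, twist, hu, hv]

theorem twist_false (D : OrientedGraph V) : D.twist (fun _ => false) = D := by
  ext u v
  simp [twist]

theorem PushRelated.exists_eq_twist {D D' : OrientedGraph V} (h : D.PushRelated D') :
    ∃ σ : V → Bool, D' = D.twist σ := by
  classical
  induction h with
  | refl => exact ⟨_, D.twist_false.symm⟩
  | tail _ hx ih =>
    obtain ⟨σ, rfl⟩ := ih
    obtain ⟨x, rfl⟩ := hx
    exact ⟨_, push_twist D σ x⟩

theorem pushRelated_twist [Finite V] (D : OrientedGraph V) (σ : V → Bool) :
    D.PushRelated (D.twist σ) := by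
  classical
  have := Fintype.ofFinite V
  have H : ∀ P : Finset V, D.PushRelated (D.twist fun v => decide (v ∈ P)) := by
    intro P
    induction P using Finset.induction_on with
    | empty =>
      simp only [Finset.notMem_empty, decide_false, twist_false]
      exact Relation.ReflTransGen.refl
    | insert x P hx ih =>
      refine ih.tail ⟨x, ?_⟩
      rw [push_twist]
      congr 1
      funext v
      by_cases hv : v = x
      · subst hv
        simp [hx]
      · simp [hv]
  have := H (Finset.univ.filter fun v => σ v = true)
  simpa using this

theorem pushMapsTo_iff [Finite V] {D : OrientedGraph V} {H : OrientedGraph W} :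
    D.PushMapsTo H ↔ ∃ (φ : V → W) (σ : V → Bool), (D.twist σ).IsHom H φ := by
  constructor
  · rintro ⟨φ, D', h, hφ⟩
    obtain ⟨σ, rfl⟩ := h.exists_eq_twist
    exact ⟨φ, σ, hφ⟩
  · rintro ⟨φ, σ, hφ⟩
    exact ⟨φ, _, D.pushRelated_twist σ, hφ⟩

/-- A homomorphism to the antitwinned Paley tournament gives a pushable homomorphism to the Paley
tournament. -/
theorem pushMapsTo_pal7_of_coloring [Finite V] {D : OrientedGraph V} (κ : V → ZMod 14)
    (hκ : ∀ u v, D.Arc u v → κ v - κ u ∈ conn) : D.PushMapsTo pal7 := by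
  -- The even elements 2, 4, 8 of `conn` are squares mod 7 and the odd ones 3, 5, 13 are nonsquares,
  -- hence negatives of squares: a parity change reverses the arc.
  have key : ∀ a b : ZMod 14, b - a ∈ conn →
      (a.val % 2 = b.val % 2 → ((b.val : ZMod 7) - (a.val : ZMod 7) ≠ 0 ∧
        IsSquare ((b.val : ZMod 7) - (a.val : ZMod 7)))) ∧
      (a.val % 2 ≠ b.val % 2 → ((a.val : ZMod 7) - (b.val : ZMod 7) ≠ 0 ∧
        IsSquare ((a.val : ZMod 7) - (b.val : ZMod 7)))) := by
    decide +kernel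
  refine pushMapsTo_iff.mpr ⟨fun v => (κ v).val, fun v => decide ((κ v).val % 2 = 1), ?_⟩
  rintro u v (⟨hσ, h⟩ | ⟨hσ, h⟩)
  · refine (key _ _ (hκ u v h)).1 ?_
    rw [decide_eq_decide] at hσ
    omega
  · refine (key _ _ (hκ v u h)).2 ?_
    rw [Ne, decide_eq_decide] at hσ
    omega

theorem adj_eq_of_maxDeg_le_three [Fintype V] {G : SimpleGraph V} (h : G.maxDeg ≤ 3)
    (v a b c d : V) (ha : G.Adj v a) (hb : G.Adj v b) (hc : G.Adj v c) (hd : G.Adj v d)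
    (hab : a ≠ b) (hca : c ≠ a) (hcb : c ≠ b) (hda : d ≠ a) (hdb : d ≠ b) : c = d := by
  classical
  by_contra hcd
  have hsub : ({a, b, c, d} : Finset V) ⊆ G.neighborFinset v := by
    intro x
    simp only [Finset.mem_insert, Finset.mem_singleton, SimpleGraph.mem_neighborFinset]
    rintro (rfl | rfl | rfl | rfl) <;> assumption
  have h4 := Finset.card_le_card hsub
  rw [Finset.card_eq_of_equiv_fin (n := 4)] at h4
  · have h1 := G.degree_le_maxDegree v
    have h2 : G.maxDegree ≤ 3 := by
      convert h using 1
      unfold SimpleGraph.maxDeg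
      congr!
    rw [SimpleGraph.card_neighborFinset_eq_degree] at h4
    omega
  · refine Finset.equivFinOfCardEq ?_
    rw [Finset.card_insert_of_notMem, Finset.card_insert_of_notMem, Finset.card_pair hcd] <;>
      simp [hab, hca.symm, hcb.symm, hda.symm, hdb.symm]

/-- Every finite subcubic oriented graph admits a pushable homomorphism to the Paley tournament. -/
theorem pushMapsTo_pal7_of_maxDeg_le_three [Fintype V] (D : OrientedGraph V)
    (h : D.underlying.maxDeg ≤ 3) : D.PushMapsTo pal7 := by
  classical
  obtain ⟨κ, hκ⟩ := exists_coloring (G := D.underlying) (s := fun u v => if D.Arc u v then 0 else 7)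
    (by
      rintro u v (h | h)
      · simp [h, D.asymm _ _ h]
      · simp [h, D.asymm _ _ h])
    (adj_eq_of_maxDeg_le_three h) Finset.univ
  refine pushMapsTo_pal7_of_coloring κ fun u v huv => ?_
  simpa [EdgeOK, huv] using hκ u (Finset.mem_univ u) v (Finset.mem_univ v) (Or.inl huv)

/-! ### Bounds for the pushable chromatic number, and the oriented `K₃,₃` -/

theorem pushChromatic_le {D : OrientedGraph V} {n : ℕ} {H : OrientedGraph (Fin n)}
    (h : D.PushMapsTo H) : D.pushChromatic ≤ n :=
  iInf₂_le (f := fun (n : ℕ) (_ : n ∈ {n : ℕ | ∃ H : OrientedGraph (Fin n), D.PushMapsTo H}) =>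
    (n : ℕ∞)) n ⟨H, h⟩

theorem le_pushChromatic {D : OrientedGraph V} {m : ℕ}
    (h : ∀ n (H : OrientedGraph (Fin n)), D.PushMapsTo H → m ≤ n) : (m : ℕ∞) ≤ D.pushChromatic :=
  le_iInf₂ fun n ⟨H, hH⟩ => Nat.cast_le.mpr (h n H hH)

/-- The oriented graph on `W` that corresponds to `D` under a bijection of the vertex sets. -/
def transport (D : OrientedGraph V) (e : W ≃ V) : OrientedGraph W where
  Arc u v := D.Arc (e u) (e v)
  asymm _ _ := D.asymm _ _

theorem isHom_transport (D : OrientedGraph V) (e : W ≃ V) : D.IsHom (D.transport e) e.symm :=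
  fun u v h => by simpa [transport] using h

theorem PushMapsTo.of_transport [Finite V] [Finite W] {U : Type*} {D : OrientedGraph V}
    {H : OrientedGraph U} {e : W ≃ V} (h : (D.transport e).PushMapsTo H) : D.PushMapsTo H := by
  obtain ⟨φ, σ, hφ⟩ := pushMapsTo_iff.mp h
  refine pushMapsTo_iff.mpr ⟨φ ∘ e.symm, σ ∘ e.symm, fun u v huv => hφ _ _ ?_⟩
  simpa [twist, transport] using huv

theorem IsHom.pushMapsTo {D : OrientedGraph V} {H : OrientedGraph W} {φ : V → W}
    (h : D.IsHom H φ) : D.PushMapsTo H :=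
  ⟨φ, D, Relation.ReflTransGen.refl, h⟩

instance : DecidableRel orientedK33.Arc := fun u v =>
  inferInstanceAs (Decidable ((∃ i j, i ≠ j ∧ u = Sum.inl i ∧ v = Sum.inr j) ∨
    (∃ i, u = Sum.inr i ∧ v = Sum.inl i)))

/-- No push makes two vertices of the orientation of `K₃,₃` identifiable: they are joined by an arc
or by directed paths of length two. -/
theorem orientedK33_conflict : ∀ u v : Fin 3 ⊕ Fin 3, u ≠ v →
    (orientedK33.Arc u v ∨ orientedK33.Arc v u) ∨
    ((∃ x, orientedK33.Arc u x ∧ orientedK33.Arc x v) ∧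
      ((∃ x, orientedK33.Arc u x ∧ orientedK33.Arc v x) ∨
        ∃ x, orientedK33.Arc x u ∧ orientedK33.Arc x v)) := by
  decide

theorem six_le_of_orientedK33_pushMapsTo {n : ℕ} {H : OrientedGraph (Fin n)}
    (h : orientedK33.PushMapsTo H) : 6 ≤ n := by
  obtain ⟨φ, σ, hφ⟩ := pushMapsTo_iff.mp h
  have harc : ∀ u v, orientedK33.Arc u v →
      (σ u = σ v ∧ H.Arc (φ u) (φ v)) ∨ (σ u ≠ σ v ∧ H.Arc (φ v) (φ u)) := by
    intro u v huv
    by_cases hσ : σ u = σ v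
    · exact Or.inl ⟨hσ, hφ u v (Or.inl ⟨hσ, huv⟩)⟩
    · exact Or.inr ⟨hσ, hφ v u (Or.inr ⟨Ne.symm hσ, huv⟩)⟩
  have hinj : Function.Injective φ := by
    intro u v heq
    by_contra hne
    have hloop := H.arc_irrefl
    rcases orientedK33_conflict u v hne with (h | h) | ⟨⟨x, hx1, hx2⟩, ⟨y, hy1, hy2⟩ | ⟨y, hy1, hy2⟩⟩
    · have := harc _ _ h
      simp_all
    · have := harc _ _ h
      simp_all
    -- The path through `x` is directed and the one through `y` is not. If `σ u = σ v` both keep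
    -- their type, otherwise they swap; identifying `u` and `v` then makes the directed one a pair
    -- of opposite arcs in `H`.
    · have h1 := harc _ _ hx1
      have h2 := harc _ _ hx2
      have h3 := harc _ _ hy1
      have h4 := harc _ _ hy2
      have a1 := H.asymm (φ u) (φ x)
      have a2 := H.asymm (φ u) (φ y)
      rw [← heq] at h2 h4
      revert h1 h2 h3 h4
      cases σ u <;> cases σ v <;> cases σ x <;> cases σ y <;> simp <;> tauto
    · have h1 := harc _ _ hx1
      have h2 := harc _ _ hx2
      have h3 := harc _ _ hy1
      have h4 := harc _ _ hy2
      have a1 := H.asymm (φ u) (φ x)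
      have a2 := H.asymm (φ u) (φ y)
      rw [← heq] at h2 h4
      revert h1 h2 h3 h4
      cases σ u <;> cases σ v <;> cases σ x <;> cases σ y <;> simp <;> tauto
  simpa using Fintype.card_le_of_injective φ hinj

theorem orientedK33_underlying :
    orientedK33.underlying = completeBipartiteGraph (Fin 3) (Fin 3) := by
  ext u v
  revert u v
  change ∀ u v, (orientedK33.Arc u v ∨ orientedK33.Arc v u) ↔
    (u.isLeft ∧ v.isRight ∨ u.isRight ∧ v.isLeft)
  decide

theorem orientedK33_pushChromatic : orientedK33.pushChromatic = 6 :=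
  le_antisymm
    (pushChromatic_le (isHom_transport orientedK33 finSumFinEquiv.symm).pushMapsTo)
    (le_pushChromatic (m := 6) fun _ _ h => six_le_of_orientedK33_pushMapsTo h)

end OrientedGraph

/-! ### Families of graphs with bounded degree -/

namespace GraphFamily

open OrientedGraph

theorem pushChromatic_mono {F F' : GraphFamily} (h : F ⊆ F') :
    F.pushChromatic ≤ F'.pushChromatic :=
  biSup_mono h

theorem pushChromatic_maxDegLE_three : (maxDegLE 3).pushChromatic ≤ 7 := by
  refine iSup₂_le fun G hG => iSup₂_le fun D hD => ?_
  -- `ZMod 7` unfolds to `Fin 7`, so `pal7` itself is a target on seven vertices.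
  refine pushChromatic_le (H := (pal7 : OrientedGraph (Fin 7)))
    (pushMapsTo_pal7_of_maxDeg_le_three D ?_)
  have heq : D.underlying = G.2 := hD
  rw [heq]
  exact hG

/-- A copy of the oriented `K₃,₃` on the vertex set `{0, …, 5}`. -/
def finOrientedK33 : OrientedGraph (Fin 6) :=
  orientedK33.transport (finSumFinEquiv (m := 3) (n := 3)).symm

instance : DecidableRel finOrientedK33.underlying.Adj := fun u v =>
  inferInstanceAs (Decidable
    (orientedK33.Arc ((finSumFinEquiv (m := 3) (n := 3)).symm u) (finSumFinEquiv.symm v) ∨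
      orientedK33.Arc ((finSumFinEquiv (m := 3) (n := 3)).symm v) (finSumFinEquiv.symm u)))

theorem finOrientedK33_connected : finOrientedK33.underlying.Connected := by
  have h : ∀ u v, u = v ∨ finOrientedK33.underlying.Adj u v ∨
      ∃ x, finOrientedK33.underlying.Adj u x ∧ finOrientedK33.underlying.Adj x v := by
    decide +kernel
  refine ⟨fun u v => ?_⟩
  rcases h u v with rfl | h | ⟨x, h1, h2⟩
  · exact SimpleGraph.Reachable.refl _
  · exact h.reachable
  · exact h1.reachable.trans h2.reachable

theorem finOrientedK33_mem : (⟨6, finOrientedK33.underlying⟩ : Σ n, SimpleGraph (Fin n)) ∈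
    connMaxDegEq 3 := by
  have hreg : finOrientedK33.underlying.IsRegularOfDegree 3 := by
    change ∀ v, finOrientedK33.underlying.degree v = 3
    decide +kernel
  refine ⟨finOrientedK33_connected, ?_⟩
  have h := hreg.maxDegree_eq
  unfold SimpleGraph.maxDeg
  convert h

theorem six_le_pushChromatic_connMaxDegEq_three : 6 ≤ (connMaxDegEq 3).pushChromatic := by
  have h1 : 6 ≤ finOrientedK33.pushChromatic :=
    le_pushChromatic (m := 6) fun _ _ h =>
      six_le_of_orientedK33_pushMapsTo (PushMapsTo.of_transport h)
  have h2 : finOrientedK33.pushChromatic ≤ finOrientedK33.underlying.pushChromatic :=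
    le_iSup₂_of_le (f := fun (D : OrientedGraph (Fin 6)) (_ : D ∈ {D : OrientedGraph (Fin 6) |
      D.underlying = finOrientedK33.underlying}) => D.pushChromatic) finOrientedK33 rfl le_rfl
  have h3 : finOrientedK33.underlying.pushChromatic ≤ (connMaxDegEq 3).pushChromatic :=
    le_iSup₂_of_le (f := fun (G : Σ n, SimpleGraph (Fin n)) (_ : G ∈ connMaxDegEq 3) =>
      G.2.pushChromatic) _ finOrientedK33_mem le_rfl
  exact h1.trans (h2.trans h3)

end GraphFamily

theorem theorem4 :
    -- the bounds for the graphs with maximum degree exactly three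
    ((6 : ℕ∞) ≤ (GraphFamily.connMaxDegEq 3).pushChromatic ∧
      (GraphFamily.connMaxDegEq 3).pushChromatic ≤ (GraphFamily.maxDegEq 3).pushChromatic ∧
      (GraphFamily.maxDegEq 3).pushChromatic ≤ 7) ∧
    -- the bounds for the graphs with maximum degree at most three
    ((6 : ℕ∞) ≤ (GraphFamily.connMaxDegLE 3).pushChromatic ∧
      (GraphFamily.connMaxDegLE 3).pushChromatic ≤ (GraphFamily.maxDegLE 3).pushChromatic ∧
      (GraphFamily.maxDegLE 3).pushChromatic ≤ 7) ∧
    -- every finite subcubic oriented graph admits a pushable homomorphism to the Paley tournament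
    (∀ (V : Type*) [Fintype V] (D : OrientedGraph V),
      D.underlying.maxDeg ≤ 3 → D.PushMapsTo OrientedGraph.pal7) ∧
    -- an explicit orientation of a connected cubic graph has pushable chromatic number six
    (OrientedGraph.orientedK33.underlying = completeBipartiteGraph (Fin 3) (Fin 3) ∧
      OrientedGraph.orientedK33.pushChromatic = 6) := by
  have hle : GraphFamily.connMaxDegEq 3 ⊆ GraphFamily.connMaxDegLE 3 :=
    fun _ h => ⟨h.1, h.2.le⟩
  have heq : GraphFamily.maxDegEq 3 ⊆ GraphFamily.maxDegLE 3 := fun _ h => Eq.le h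
  refine ⟨⟨GraphFamily.six_le_pushChromatic_connMaxDegEq_three,
    GraphFamily.pushChromatic_mono fun _ h => h.2,
    (GraphFamily.pushChromatic_mono heq).trans GraphFamily.pushChromatic_maxDegLE_three⟩,
    ⟨GraphFamily.six_le_pushChromatic_connMaxDegEq_three.trans
      (GraphFamily.pushChromatic_mono hle),
    GraphFamily.pushChromatic_mono fun _ h => h.2, GraphFamily.pushChromatic_maxDegLE_three⟩,
    fun V _ D h => D.pushMapsTo_pal7_of_maxDeg_le_three h,
    OrientedGraph.orientedK33_underlying, OrientedGraph.orientedK33_pushChromatic⟩
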